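/- Draw the triangular lattice with vertex set $\mathbb{Z}^2$, each vertex $v$ being joined by an edge to $v\pm(1,0)$, $v\pm(1,-1)$ and $v\pm(0,1)$. For $m\ge 1$ let $\mathcal{T}_m=\{(x,y)\in\mathbb{Z}^2 : 1-m\le x\le 0,\ 0\le y\le m-1,\ x+y\ge 0\}$ be the triangle with corners $(0,0)$, $(1-m,m-1)$, $(0,m-1)$. A $20V_3$ configuration on $\mathcal{T}_m$ is a choice of orientation of all lattice edges having at least one endpoint in $\mathcal{T}_m$ such that every vertex of $\mathcal{T}_m$ has exactly three incoming and three outgoing edges (ice rule), and such that the edges with exactly one endpoint in $\mathcal{T}_m$ (boundary edges) are oriented as follows: (i) all boundary edges on the North side (those whose outer endpoint has $y=m$) point out of $\mathcal{T}_m$; (ii) all boundary edges on the East side (those whose outer endpoint has $x=1$) point into $\mathcal{T}_m$; (iii) at a vertex $(-y,y)$ of the diagonal side $x+y=0$, the two boundary edges to $(-y-1,y)$ and $(-y,y-1)$ both point into $\mathcal{T}_m$ if $2y>m-1$ (top half), and both point out of $\mathcal{T}_m$ if $2y<m-1$ (bottom half); at the centre vertex $2y=m-1$, which exists only for odd $m$,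 the horizontal boundary edge points in and the vertical boundary edge points out. Let $Z_m^{20V_3}$ be the number of $20V_3$ configurations on $\mathcal{T}_m$. Then for every integer $n\ge 1$, $$Z_{2n}^{20V_3}=2^{n}\,Z_{2n-1}^{20V_3}.$$ -/

import Mathlib

/-- The triangular lattice is drawn with vertex set `ℤ × ℤ`; each edge joins `p` to `p + s`, where
`s` is the horizontal step `(1, 0)`, the diagonal step `(1, -1)` or the vertical step `(0, -1)`. -/
def latticeSteps : Finset (ℤ × ℤ) := {(1, 0), (1, -1), (0, -1)}

/-- The vertices of the triangle `𝒯_m`: the lattice points of the triangle with corners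
`(0, 0)`, `(1 - m, m - 1)` and `(0, m - 1)`. -/
noncomputable def triangleVertices (m : ℕ) : Finset (ℤ × ℤ) :=
  (Finset.Icc (1 - (m : ℤ)) 0 ×ˢ Finset.Icc (0 : ℤ) ((m : ℤ) - 1)).filter
    fun p => 0 ≤ p.1 + p.2

/-- The lattice edges that touch `𝒯_m`, the external (boundary) edges included. An edge is recorded
once, as the pair `(p, p + s)` with `s` one of the three steps. -/
noncomputable def triangleEdges (m : ℕ) : Finset ((ℤ × ℤ) × (ℤ × ℤ)) :=
  (triangleVertices m).biUnion fun v =>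
    latticeSteps.biUnion fun s => {(v, v + s), (v - s, v)}

/-- A choice of orientation of every edge touching `𝒯_m`: the value `true` at `(p, q)` means that
the edge points from `p` to `q`, the value `false` that it points from `q` to `p`. -/
abbrev EdgeOrientation (m : ℕ) : Type := triangleEdges m → Bool

namespace EdgeOrientation

variable {m : ℕ}

/-- The vertex that the oriented edge `e` points away from. -/
def tail (σ : EdgeOrientation m) (e : triangleEdges m) : ℤ × ℤ :=
  if σ e = true then e.1.1 else e.1.2

/-- The vertex that the oriented edge `e` points to. -/
def head (σ : EdgeOrientation m) (e : triangleEdges m) : ℤ × ℤ :=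
  if σ e = true then e.1.2 else e.1.1

/-- The ice rule at `v`: three incoming and three outgoing edges. -/
def IceRule (σ : EdgeOrientation m) (v : ℤ × ℤ) : Prop :=
  (Finset.univ.filter fun e => σ.head e = v).card = 3 ∧
    (Finset.univ.filter fun e => σ.tail e = v).card = 3

/-- The edge `e` crosses the boundary of `𝒯_m` and points into the domain. -/
def PointsIn (σ : EdgeOrientation m) (e : triangleEdges m) : Prop :=
  σ.tail e ∉ triangleVertices m ∧ σ.head e ∈ triangleVertices m

/-- The edge `e` crosses the boundary of `𝒯_m` and points out of the domain. -/
def PointsOut (σ : EdgeOrientation m) (e : triangleEdges m) : Prop :=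
  σ.tail e ∈ triangleVertices m ∧ σ.head e ∉ triangleVertices m

end EdgeOrientation

/-- A vertical or diagonal external edge at the North boundary `y = m - 1`
(its upper end lies on `y = m`). -/
def IsNorthEdge {m : ℕ} (e : triangleEdges m) : Prop := e.1.1.2 = (m : ℤ)

/-- A horizontal or diagonal external edge at the East boundary `x = 0`
(its right end lies on `x = 1`). -/
def IsEastEdge {m : ℕ} (e : triangleEdges m) : Prop := e.1.2.1 = 1

/-- A horizontal external edge at the diagonal boundary `x + y = 0`: its left end lies on
`x + y = -1`, and its right end is a vertex of the diagonal boundary. -/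
def IsDiagHorizontalEdge {m : ℕ} (e : triangleEdges m) : Prop := e.1.1.1 + e.1.1.2 = -1

/-- A vertical external edge at the diagonal boundary `x + y = 0`: its lower end lies on
`x + y = -1`, and its upper end is a vertex of the diagonal boundary. -/
def IsDiagVerticalEdge {m : ℕ} (e : triangleEdges m) : Prop := e.1.2.1 + e.1.2.2 = -1

/-- The configurations of the twenty-vertex model `20V₃` on the triangle `𝒯_m`. For both kinds of
external edge at the diagonal boundary, `e.1.1.2` is the height `y` of the boundary vertex that the
edge is attached to; the heights run from `0` to `m - 1`, so the upper half is `m - 1 < 2 * y`, the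
lower half is `2 * y < m - 1`, and equality holds at the centre vertex, which exists for odd `m`. -/
structure Is20V3Configuration {m : ℕ} (σ : EdgeOrientation m) : Prop where
  ice : ∀ v ∈ triangleVertices m, σ.IceRule v
  north : ∀ e, IsNorthEdge e → σ.PointsOut e
  east : ∀ e, IsEastEdge e → σ.PointsIn e
  diag_upper : ∀ e : triangleEdges m, IsDiagHorizontalEdge e ∨ IsDiagVerticalEdge e →
    (m : ℤ) - 1 < 2 * e.1.1.2 → σ.PointsIn e
  diag_lower : ∀ e : triangleEdges m, IsDiagHorizontalEdge e ∨ IsDiagVerticalEdge e →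
    2 * e.1.1.2 < (m : ℤ) - 1 → σ.PointsOut e
  centre_horizontal : ∀ e : triangleEdges m, IsDiagHorizontalEdge e →
    2 * e.1.1.2 = (m : ℤ) - 1 → σ.PointsIn e
  centre_vertical : ∀ e : triangleEdges m, IsDiagVerticalEdge e →
    2 * e.1.1.2 = (m : ℤ) - 1 → σ.PointsOut e

/-- `Z_m`, the number of `20V₃` configurations on `𝒯_m`. -/
noncomputable def Z20V3 (m : ℕ) : ℕ :=
  Nat.card {σ : EdgeOrientation m // Is20V3Configuration σ}

/-! Read `true` on an edge as a path running right, down or diagonally down-right. The ice rule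
becomes conservation of paths, no path crosses the North or East boundary, and the diagonal side
prescribes where paths enter and leave. The diagonal lattice lines are the antidiagonals of the
triangle, so the count is a composition of antidiagonal transfer operators, running from the
diagonal side to the corner `(0, m - 1)`.

Each vertex can be pulled apart into three six-vertex crossings of total weight 1, with the diagonal
line passing on either side of the horizontal-vertical crossing. This is a Yang–Baxter relation
(`layerIce_eq_layerHV`, `layerIce_eq_diagHV`). A diagonal line carries no path at its two ends, so
it can be pushed through layer after layer until it vanishes at the corner with factor 1
(`diagVH_corner`, `diagHV_partitionHV`). What remains is a six-vertex model on the same triangle,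
where a vertical path crossing an empty horizontal line has weight 2 and every other allowed vertex
has weight 1 (`partitionIce_eq_partitionHV`).

In size `2n`, exactly one of the left and bottom edges at each vertex of the diagonal side carries a
path. This forces every path of the first layer to go straight: the `n` vertical ones give `2 ^ n`,
and the rest is the triangle of size `2n - 1` with its own boundary bits (`partitionHV_frozen`). The
identification of `Z20V3` with the transfer operators is `Z20V3_eq_partitionIce`. -/

namespace TwentyVertex

/-! ### Bit sequences, crossing weights and transfer operators. -/

/-- A bit sequence with a new first bit. -/
def cons (a : Bool) (s : ℕ → Bool) : ℕ → Bool
  | 0 => a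
  | i + 1 => s i

/-- A bit sequence without its first bit. -/
def shift (s : ℕ → Bool) : ℕ → Bool := fun i => s (i + 1)

@[simp] theorem cons_zero (a : Bool) (s : ℕ → Bool) : cons a s 0 = a := rfl

@[simp] theorem cons_succ (a : Bool) (s : ℕ → Bool) (i : ℕ) : cons a s (i + 1) = s i := rfl

@[simp] theorem shift_cons (a : Bool) (s : ℕ → Bool) : shift (cons a s) = s := rfl

@[simp] theorem cons_false_false : cons false (fun _ => false) = fun _ => false := by
  funext i; cases i <;> rfl

/-- Functions of the pair of bit sequences carried by the edges between two antidiagonals. -/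
abbrev Obs : Type := (ℕ → Bool) → (ℕ → Bool) → ℚ

/-- The observable obtained by fixing the first bit of both sequences. -/
def Obs.fix (f : Obs) (a b : Bool) : Obs := fun S T => f (cons a S) (cons b T)

/-- Six-vertex weight of a crossing of a horizontal and a vertical line: path bits
`l` (left), `b` (bottom), `t` (top), `r` (right). -/
def weightHV (l b t r : Bool) : ℚ :=
  if l.toNat + t.toNat = r.toNat + b.toNat then (if !l && b && t && !r then 2 else 1) else 0

/-- Six-vertex weight of a crossing of a diagonal and a horizontal line: path bits
`d`, `l` enter and `r`, `e` leave. -/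
def weightDH (d l r e : Bool) : ℚ :=
  if d.toNat + l.toNat = r.toNat + e.toNat then (if d && l then 2 else 1) else 0

/-- Six-vertex weight of a crossing of a diagonal and a vertical line: path bits
`d`, `t` enter and `b`, `e` leave. -/
def weightDV (d b t e : Bool) : ℚ :=
  if d.toNat + t.toNat = b.toNat + e.toNat then (if d || t then 1 / 2 else 1) else 0

/-- The ice rule in terms of path bits, with `d` the diagonal bit that enters and `e` the diagonal
bit that leaves. -/
def Ice (d l b t r e : Bool) : Prop :=
  l.toNat + t.toNat + d.toNat = r.toNat + b.toNat + e.toNat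

instance (d l b t r e : Bool) : Decidable (Ice d l b t r e) := by unfold Ice; infer_instance

/-- The twenty-vertex weight. -/
def weightIce (d l b t r e : Bool) : ℚ := if Ice d l b t r e then 1 else 0

/-- An antidiagonal layer of six-vertex crossings. -/
def layerHV : ℕ → (L B : ℕ → Bool) → Obs → ℚ
  | 0, _, _, f => f (fun _ => false) (fun _ => false)
  | k + 1, L, B, f => ∑ t : Bool, ∑ r : Bool,
      weightHV (L 0) (B 0) t r * layerHV k (shift L) (shift B) (f.fix t r)

/-- A diagonal line that crosses horizontal and vertical lines alternately, starting with a
horizontal one. -/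
def diagHV : ℕ → Bool → (L B : ℕ → Bool) → Obs → ℚ
  | 0, d, _, _, f => if d = false then f (fun _ => false) (fun _ => false) else 0
  | k + 1, d, L, B, f => ∑ l : Bool, ∑ d' : Bool, ∑ b : Bool, ∑ e : Bool,
      weightDH d (L 0) l d' * weightDV d' (B 0) b e * diagHV k e (shift L) (shift B) (f.fix l b)

/-- A diagonal line that crosses vertical and horizontal lines alternately, starting with a
vertical one. -/
def diagVH : ℕ → Bool → (T R : ℕ → Bool) → Obs → ℚ
  | 0, d, _, _, f => if d = false then f (fun _ => false) (fun _ => false) else 0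
  | k + 1, d, T, R, f => ∑ t : Bool, ∑ d' : Bool, ∑ r : Bool, ∑ e : Bool,
      weightDV d (T 0) t d' * weightDH d' (R 0) r e * diagVH k e (shift T) (shift R) (f.fix t r)

/-- An antidiagonal layer of vertices of the twenty-vertex model. -/
def layerIce : ℕ → Bool → (L B : ℕ → Bool) → Obs → ℚ
  | 0, d, _, _, f => if d = false then f (fun _ => false) (fun _ => false) else 0
  | k + 1, d, L, B, f => ∑ t : Bool, ∑ r : Bool, ∑ e : Bool,
      weightIce d (L 0) (B 0) t r e * layerIce k e (shift L) (shift B) (f.fix t r)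

/-! ### Linearity of the transfer operators and the Yang–Baxter relation. -/

theorem layerHV_add (k : ℕ) (L B : ℕ → Bool) (f g : Obs) :
    layerHV k L B (fun S T => f S T + g S T) = layerHV k L B f + layerHV k L B g := by
  induction k generalizing L B f g with
  | zero => rfl
  | succ k ih =>
    have h (t r : Bool) : Obs.fix (fun S T => f S T + g S T) t r =
      fun S T => f.fix t r S T + g.fix t r S T := rfl
    simp only [layerHV, h, ih, mul_add, Finset.sum_add_distrib]

theorem layerHV_mul (k : ℕ) (L B : ℕ → Bool) (c : ℚ) (f : Obs) :
    layerHV k L B (fun S T => c * f S T) = c * layerHV k L B f := by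
  induction k generalizing L B f with
  | zero => rfl
  | succ k ih =>
    have h (t r : Bool) : Obs.fix (fun S T => c * f S T) t r = fun S T => c * f.fix t r S T := rfl
    simp only [layerHV, h, ih, Finset.mul_sum, mul_left_comm]

theorem diagHV_add (k : ℕ) (d : Bool) (L B : ℕ → Bool) (f g : Obs) :
    diagHV k d L B (fun S T => f S T + g S T) = diagHV k d L B f + diagHV k d L B g := by
  induction k generalizing d L B f g with
  | zero => cases d <;> simp [diagHV]
  | succ k ih =>
    have h (t r : Bool) : Obs.fix (fun S T => f S T + g S T) t r =
      fun S T => f.fix t r S T + g.fix t r S T := rfl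
    simp only [diagHV, h, ih, mul_add, Finset.sum_add_distrib]

theorem diagHV_mul (k : ℕ) (d : Bool) (L B : ℕ → Bool) (c : ℚ) (f : Obs) :
    diagHV k d L B (fun S T => c * f S T) = c * diagHV k d L B f := by
  induction k generalizing d L B f with
  | zero => cases d <;> simp [diagHV]
  | succ k ih =>
    have h (t r : Bool) : Obs.fix (fun S T => c * f S T) t r = fun S T => c * f.fix t r S T := rfl
    simp only [diagHV, h, ih, Finset.mul_sum, mul_left_comm]

/-- The twenty-vertex layer is a six-vertex layer followed by a diagonal line. -/
theorem layerIce_eq_layerHV (k : ℕ) (d : Bool) (L B : ℕ → Bool) (f : Obs) :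
    layerIce k d L B f = layerHV k L B (fun T R => diagVH k d T R f) := by
  induction k generalizing d L B f with
  | zero => rfl
  | succ k ih =>
    have h (t r : Bool) : Obs.fix (fun T R => diagVH (k + 1) d T R f) t r =
      fun T R => ∑ t' : Bool, ∑ d' : Bool, ∑ r' : Bool, ∑ e : Bool,
      weightDV d t t' d' * weightDH d' r r' e * diagVH k e T R (f.fix t' r') := rfl
    simp only [layerIce, layerHV, h, ih, Fintype.sum_bool, layerHV_add, layerHV_mul]
    generalize L 0 = l
    generalize B 0 = b
    -- By linearity only one vertex is left to check: for fixed outer bits, the three crossing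
    -- weights summed over the three inner edges give `weightIce`.
    cases d <;> cases l <;> cases b <;>
      simp [weightIce, Ice, weightHV, weightDH, weightDV] <;> ring

/-- The twenty-vertex layer is a diagonal line followed by a six-vertex layer. -/
theorem layerIce_eq_diagHV (k : ℕ) (d : Bool) (L B : ℕ → Bool) (f : Obs) :
    layerIce k d L B f = diagHV k d L B (fun L' B' => layerHV k L' B' f) := by
  induction k generalizing d L B f with
  | zero => rfl
  | succ k ih =>
    have h (l b : Bool) : Obs.fix (fun L' B' => layerHV (k + 1) L' B' f) l b =
      fun L' B' => ∑ t : Bool, ∑ r : Bool, weightHV l b t r * layerHV k L' B' (f.fix t r) := rfl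
    simp only [layerIce, diagHV, h, ih, Fintype.sum_bool, diagHV_add, diagHV_mul]
    generalize L 0 = l
    generalize B 0 = b
    cases d <;> cases l <;> cases b <;>
      simp [weightIce, Ice, weightHV, weightDH, weightDV] <;> ring

/-! ### Sweeping the diagonal lines out of the triangle. -/

/-- Passage to the next antidiagonal: the two extreme edges leave the triangle and carry no path. -/
def corner (k : ℕ) (g : Obs) : Obs :=
  fun T R => if T 0 = false ∧ R k = false then g R (shift T) else 0

/-- This is the line after its first vertical crossing. Regrouping the crossings as
horizontal-vertical pairs leaves one last horizontal crossing, whose outgoing bits are both `false`;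
conservation makes it empty, of weight 1. The entering bit `d` is arbitrary so that the induction
can pass it on. -/
theorem diagVH_corner_aux (k : ℕ) (d : Bool) (T R : ℕ → Bool) (g : Obs) :
    ∑ r : Bool, ∑ e : Bool, weightDH d (R 0) r e *
      diagVH k e (shift T) (shift R)
        (fun T' R' => if cons r R' k = false then g (cons r R') T' else 0) =
    if R k = false then diagHV k d R (shift T) g else 0 := by
  induction k generalizing d T R g with
  | zero =>
    simp only [Fintype.sum_bool, diagVH, diagHV, cons_zero]
    generalize R 0 = r
    cases d <;> cases r <;> simp [weightDH]
  | succ k ih =>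
    have h (r t r' : Bool) : Obs.fix (fun T' R' => if cons r R' (k + 1) = false then
        g (cons r R') T' else 0) t r' =
      fun T' R' => if cons r' R' k = false then (g.fix r t) (cons r' R') T' else 0 := rfl
    have key (r t e : Bool) := ih e (shift T) (shift R) (g.fix r t)
    simp only [diagVH, diagHV, h, mul_assoc, ← Finset.mul_sum, key]
    change _ = if shift R k = false then _ else 0
    split_ifs <;> simp

/-- The first and last crossings of the line lie on the North and East edges, which carry no path;
they are empty and have weight 1. Dropping both turns the vertical-first line into a
horizontal-first line on the next, shorter antidiagonal. -/
theorem diagVH_corner (k : ℕ) (T R : ℕ → Bool) (g : Obs) :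
    diagVH (k + 1) false T R (corner k g) = corner k (fun L B => diagHV k false L B g) T R := by
  have h0 (r : Bool) : Obs.fix (corner k g) false r =
      fun T' R' => if cons r R' k = false then g (cons r R') T' else 0 := by
    funext T' R'; simp [corner, Obs.fix]
  have h1 (r : Bool) : Obs.fix (corner k g) true r = fun _ _ => 0 := by
    funext T' R'; simp [corner, Obs.fix]
  have hz (k : ℕ) : ∀ (d : Bool) (T R : ℕ → Bool),
      diagVH k d T R (fun _ _ => 0) = 0 := by
    induction k with
    | zero => intro d T R; simp [diagVH]
    | succ k ih =>
      intro d T R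
      have h (t r : Bool) : Obs.fix (fun _ _ => 0) t r = fun _ _ => 0 := rfl
      simp only [diagVH, h, ih, mul_zero, Finset.sum_const_zero]
  have key (d : Bool) := diagVH_corner_aux k d T R g
  simp only [diagVH]
  simp only [mul_assoc, ← Finset.mul_sum]
  rw [Fintype.sum_bool]
  simp only [h0, h1, hz, key, mul_zero, Finset.sum_const_zero, zero_add]
  rw [Fintype.sum_bool]
  unfold corner
  generalize T 0 = t
  -- With the entering diagonal bit and the top bit both `false`, conservation forces the bottom bit
  -- and the leaving diagonal bit to be `false`.
  cases t <;> simp [weightDV]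

/-- Partition function of the twenty-vertex model on the triangle of size `k`, as a function of the
bits of the left and bottom edges along its diagonal side. -/
def partitionIce : ℕ → Obs
  | 0 => fun _ _ => 1
  | k + 1 => fun L B => layerIce (k + 1) false L B (corner k (partitionIce k))

/-- Partition function of the six-vertex model on the triangle of size `k`. -/
def partitionHV : ℕ → Obs
  | 0 => fun _ _ => 1
  | k + 1 => fun L B => layerHV (k + 1) L B (corner k (partitionHV k))

theorem layerIce_corner_partitionHV (k : ℕ) (L B : ℕ → Bool)
    (h : ∀ L B, diagHV k false L B (partitionHV k) = partitionHV k L B) :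
    layerIce (k + 1) false L B (corner k (partitionHV k)) = partitionHV (k + 1) L B := by
  rw [layerIce_eq_layerHV]
  simp only [diagVH_corner, h]
  rfl

/-- Yang–Baxter moves the line across the first layer, `diagVH_corner` passes it to the smaller
triangle, and the induction hypothesis absorbs it there. -/
theorem diagHV_partitionHV (k : ℕ) (L B : ℕ → Bool) :
    diagHV k false L B (partitionHV k) = partitionHV k L B := by
  induction k generalizing L B with
  | zero => simp [diagHV, partitionHV]
  | succ k ih =>
    rw [← layerIce_corner_partitionHV k L B ih, layerIce_eq_diagHV]
    rfl

theorem partitionIce_eq_partitionHV (k : ℕ) : partitionIce k = partitionHV k := by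
  induction k with
  | zero => rfl
  | succ k ih =>
    funext L B
    rw [← layerIce_corner_partitionHV k L B (diagHV_partitionHV k), ← ih]
    rfl

/-! ### The frozen first layer in even size. -/

/-- The restriction of a bit sequence to its first `k` bits. -/
def truncate (k : ℕ) (s : ℕ → Bool) : ℕ → Bool := fun i => decide (i < k) && s i

/-- When `l` and `b` differ, `l + t = r + b` has the single solution `t = b`, `r = l`, and the
vertex has weight `2 ^ b`. Truncation appears because `layerHV` feeds `false` beyond its `k`
vertices. -/
theorem layerHV_frozen (k : ℕ) (L B : ℕ → Bool) (f : Obs) (h : ∀ i < k, L i = !B i) :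
    layerHV k L B f = 2 ^ (∑ i ∈ Finset.range k, (B i).toNat) *
      f (truncate k B) (truncate k L) := by
  induction k generalizing L B f with
  | zero =>
    have ht (s : ℕ → Bool) : truncate 0 s = fun _ => false := by funext i; simp [truncate]
    simp [layerHV, ht]
  | succ k ih =>
    have ht (s : ℕ → Bool) : truncate (k + 1) s = cons (s 0) (truncate k (shift s)) := by
      funext i
      cases i <;> simp [truncate, shift]
    have := h 0 (by simp)
    simp only [layerHV]
    simp only [ih (shift L) (shift B) _ fun i hi => h (i + 1) (by omega)]
    rw [Finset.sum_range_succ', ht B, ht L, this]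
    simp only [Obs.fix, shift, Fintype.sum_bool]
    cases B 0 <;> simp [weightHV, pow_succ]
    ring

/-- The bits of the horizontal edges along the diagonal side of the triangle of size `m`, from the
top to the bottom: paths enter in the upper half and at the centre. -/
def leftBits (m : ℕ) : ℕ → Bool := fun i => decide (2 * i < m)

/-- The bits of the vertical edges along the diagonal side of the triangle of size `m`, from the
top to the bottom: paths leave in the lower half and at the centre. -/
def bottomBits (m : ℕ) : ℕ → Bool := fun i => decide (m ≤ 2 * i + 1 ∧ i < m)

theorem partitionHV_frozen (n : ℕ) :
    partitionHV (2 * n + 2) (leftBits (2 * n + 2)) (bottomBits (2 * n + 2)) =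
      2 ^ (n + 1) * partitionHV (2 * n + 1) (leftBits (2 * n + 1)) (bottomBits (2 * n + 1)) := by
  change layerHV (2 * n + 1 + 1) _ _ _ = _
  have hB : truncate (2 * n + 1 + 1) (bottomBits (2 * n + 2)) = bottomBits (2 * n + 2) := by
    funext i; simp [truncate, bottomBits]; omega
  -- By parity, `2 * i < 2 * n + 2` and `2 * i < 2 * n + 1` both say `i ≤ n`.
  have hL : truncate (2 * n + 1 + 1) (leftBits (2 * n + 2)) = leftBits (2 * n + 1) := by
    funext i; simp [truncate, leftBits]; grind
  -- The shift moves the first bottom path from position `n + 1` to the centre `n`, where it meets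
  -- the last left path, as odd size requires.
  have hS : shift (bottomBits (2 * n + 2)) = bottomBits (2 * n + 1) := by
    funext i; simp [shift, bottomBits]
  have hc : ∑ i ∈ Finset.range (2 * n + 1 + 1), (bottomBits (2 * n + 2) i).toNat = n + 1 := by
    have h0 : ∀ i ∈ Finset.range (n + 1), (bottomBits (2 * n + 2) i).toNat = 0 := by
      intro i hi
      have := Finset.mem_range.1 hi
      simp [bottomBits]; omega
    have h1 : ∀ i ∈ Finset.range (n + 1), (bottomBits (2 * n + 2) (n + 1 + i)).toNat = 1 := by
      intro i hi
      have := Finset.mem_range.1 hi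
      simp [bottomBits]; omega
    rw [show Finset.range (2 * n + 1 + 1) = Finset.range ((n + 1) + (n + 1)) by congr 1; ring,
      Finset.sum_range_add, Finset.sum_eq_zero h0, Finset.sum_congr rfl h1]
    simp
  rw [layerHV_frozen, hB, hL, hc, corner, hS, if_pos]
  · constructor
    · simp [bottomBits]
    · simp [leftBits]; omega
  · intro i hi
    rw [Bool.eq_iff_iff]
    simp [leftBits, bottomBits]
    omega

/-! ### Counting layered configurations by transfer operators. -/

/-- Path bits of the top, right and lower right edges of a vertex. -/
abbrev VertexBits : Type := Bool × Bool × Bool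

/-- The sequence with first term `a` and remaining terms `x`. -/
def prepend {α : Type*} (a : α) (x : ℕ → α) : ℕ → α
  | 0 => a
  | i + 1 => x i

/-- Counting pairs by the first term of their first component. -/
theorem ncard_eq_sum_prepend {α β : Type*} [Fintype α] (S : Set ((ℕ → α) × β))
    (h : ∀ a, {q : (ℕ → α) × β | (prepend a q.1, q.2) ∈ S}.Finite) :
    S.Finite ∧ S.ncard = ∑ a, {q : (ℕ → α) × β | (prepend a q.1, q.2) ∈ S}.ncard := by
  have hp (x : ℕ → α) : prepend (x 0) (fun i => x (i + 1)) = x := by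
    funext i; cases i <;> rfl
  let e : S ≃ Σ a, {q : (ℕ → α) × β | (prepend a q.1, q.2) ∈ S} :=
    { toFun := fun p => ⟨p.1.1 0, (fun i => p.1.1 (i + 1), p.1.2), by
        simp only [Set.mem_ofPred_eq, hp]; exact p.2⟩
      invFun := fun q => ⟨(prepend q.1 q.2.1.1, q.2.1.2), q.2.2⟩
      left_inv := fun p => by ext1; simp only [hp]
      right_inv := fun q => rfl }
  have (a : α) : Finite {q : (ℕ → α) × β | (prepend a q.1, q.2) ∈ S} := (h a).to_subtype
  refine ⟨@Set.toFinite _ _ (Finite.of_equiv _ e.symm), ?_⟩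
  rw [← Nat.card_coe_set_eq, Nat.card_congr e, Nat.card_sigma]
  rfl

/-- The ice rule along an antidiagonal of `k` vertices with left bits `L`, bottom bits `B` and
entering diagonal bit `d`; the diagonal line carries no path at its other end. -/
def IsLayer : ℕ → Bool → (L B : ℕ → Bool) → (ℕ → VertexBits) → Prop
  | 0, d, _, _, x => d = false ∧ ∀ i, x i = (false, false, false)
  | k + 1, d, L, B, x => Ice d (L 0) (B 0) (x 0).1 (x 0).2.1 (x 0).2.2 ∧
      IsLayer k (x 0).2.2 (shift L) (shift B) fun i => x (i + 1)

/-- `layerIce` is a fibre count: `Q T R` holds the ways to complete a layer with outgoing bits `T`,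
`R`. Finiteness is carried along because `ncard` is 0 on infinite sets, which would spoil
additivity. -/
theorem ncard_isLayer {β : Type*} (k : ℕ) (d : Bool) (L B : ℕ → Bool)
    (Q : (ℕ → Bool) → (ℕ → Bool) → Set β) (hQ : ∀ T R, (Q T R).Finite) :
    {p : (ℕ → VertexBits) × β | IsLayer k d L B p.1 ∧
      p.2 ∈ Q (fun i => (p.1 i).1) (fun i => (p.1 i).2.1)}.Finite ∧
    ({p : (ℕ → VertexBits) × β | IsLayer k d L B p.1 ∧
      p.2 ∈ Q (fun i => (p.1 i).1) (fun i => (p.1 i).2.1)}.ncard : ℚ) =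
    layerIce k d L B (fun T R => ((Q T R).ncard : ℚ)) := by
  induction k generalizing d L B Q with
  | zero =>
    cases d with
    | true => simp [IsLayer, layerIce]
    | false =>
      have : {p : (ℕ → VertexBits) × β | IsLayer 0 false L B p.1 ∧
          p.2 ∈ Q (fun i => (p.1 i).1) (fun i => (p.1 i).2.1)} =
          (fun z => (fun _ => (false, false, false), z)) ''
            Q (fun _ => false) (fun _ => false) := by
        ext ⟨x, z⟩
        simp only [IsLayer, Set.mem_ofPred_eq, Set.mem_image, Prod.mk.injEq, true_and]
        constructor
        · rintro ⟨hx, hz⟩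
          obtain rfl : x = fun _ => (false, false, false) := funext hx
          exact ⟨z, hz, rfl, rfl⟩
        · rintro ⟨w, hw, rfl, rfl⟩
          exact ⟨fun _ => rfl, hw⟩
      rw [this]
      refine ⟨(hQ _ _).image _, ?_⟩
      rw [Set.ncard_image_of_injective _ fun a b h => (Prod.mk.inj h).2]
      simp [layerIce]
  | succ k ih =>
    have hcons (g : VertexBits → Bool) (a : VertexBits) (x : ℕ → VertexBits) :
        (fun i => g (prepend a x i)) = cons (g a) fun i => g (x i) := by
      funext i; cases i <;> rfl
    have hS (a : VertexBits) : {q : (ℕ → VertexBits) × β | (prepend a q.1, q.2) ∈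
        {p : (ℕ → VertexBits) × β | IsLayer (k + 1) d L B p.1 ∧
          p.2 ∈ Q (fun i => (p.1 i).1) (fun i => (p.1 i).2.1)}} =
        {q | Ice d (L 0) (B 0) a.1 a.2.1 a.2.2 ∧ q ∈ {p : (ℕ → VertexBits) × β |
          IsLayer k a.2.2 (shift L) (shift B) p.1 ∧
          p.2 ∈ Q (cons a.1 fun i => (p.1 i).1) (cons a.2.1 fun i => (p.1 i).2.1)}} := by
      ext ⟨x, z⟩
      simp only [Set.mem_ofPred_eq, IsLayer, hcons (fun v => v.1),
        hcons (fun v => v.2.1), and_assoc]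
      rfl
    have hi (a : VertexBits) := ih a.2.2 (shift L) (shift B)
      (fun T R => Q (cons a.1 T) (cons a.2.1 R)) fun _ _ => hQ _ _
    obtain ⟨h1, h2⟩ := ncard_eq_sum_prepend _ fun a => by
      rw [hS a]
      exact (hi a).1.subset fun q hq => hq.2
    refine ⟨h1, ?_⟩
    rw [h2]
    simp only [hS]
    push_cast
    rw [layerIce, Fintype.sum_prod_type]
    refine Finset.sum_congr rfl fun t _ => ?_
    rw [Fintype.sum_prod_type]
    refine Finset.sum_congr rfl fun r _ => Finset.sum_congr rfl fun e _ => ?_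
    have := (hi (t, r, e)).2
    unfold weightIce
    split_ifs with hice
    · simp only [hice, true_and, Set.ofPred_mem_eq, one_mul]
      exact this
    · simp [hice]

/-- The configurations on a triangle of size `k`, given by the antidiagonal layers. -/
def IsLayered : ℕ → (L B : ℕ → Bool) → (ℕ → ℕ → VertexBits) → Prop
  | 0, _, _, X => ∀ j i, X j i = (false, false, false)
  | k + 1, L, B, X => IsLayer (k + 1) false L B (X 0) ∧ (X 0 0).1 = false ∧
      (X 0 k).2.1 = false ∧
      IsLayered k (fun i => (X 0 i).2.1) (fun i => (X 0 (i + 1)).1) fun j => X (j + 1)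

theorem ncard_isLayered (k : ℕ) (L B : ℕ → Bool) :
    {X | IsLayered k L B X}.Finite ∧ ({X | IsLayered k L B X}.ncard : ℚ) = partitionIce k L B := by
  induction k generalizing L B with
  | zero =>
    have : {X | IsLayered 0 L B X} = {fun _ _ => (false, false, false)} := by
      ext X
      simp [IsLayered, funext_iff]
    rw [this]
    simp [partitionIce]
  | succ k ih =>
    -- The two empty boundary edges are part of `Q`, so that its cardinality is exactly the `corner`
    -- observable.
    let Q : (ℕ → Bool) → (ℕ → Bool) → Set (ℕ → ℕ → VertexBits) := fun T R =>
      {X | (T 0 = false ∧ R k = false) ∧ X ∈ {X | IsLayered k R (shift T) X}}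
    have hQ (T R) : (Q T R).Finite := (ih R (shift T)).1.subset fun X hX => hX.2
    have hQc (T R) : ((Q T R).ncard : ℚ) = corner k (partitionIce k) T R := by
      unfold corner
      split_ifs with h
      · simp only [Q, h, true_and, and_self, Set.ofPred_mem_eq]
        exact (ih R (shift T)).2
      · simp [Q, h]
    obtain ⟨h1, h2⟩ := ncard_isLayer (k + 1) false L B Q hQ
    have himage : {X | IsLayered (k + 1) L B X} = (fun p => prepend p.1 p.2) ''
        {p : (ℕ → VertexBits) × (ℕ → ℕ → VertexBits) | IsLayer (k + 1) false L B p.1 ∧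
          p.2 ∈ Q (fun i => (p.1 i).1) (fun i => (p.1 i).2.1)} := by
      ext X
      constructor
      · rintro ⟨ha, hb, hc, hd⟩
        refine ⟨(X 0, fun j => X (j + 1)), ⟨ha, ⟨hb, hc⟩, hd⟩, ?_⟩
        funext j; cases j <;> rfl
      · rintro ⟨⟨x, Y⟩, ⟨ha, ⟨hb, hc⟩, hd⟩, rfl⟩
        exact ⟨ha, hb, hc, hd⟩
    have hinj : Function.Injective
        fun p : (ℕ → VertexBits) × (ℕ → ℕ → VertexBits) => prepend p.1 p.2 := by
      rintro ⟨x, Y⟩ ⟨x', Y'⟩ h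
      exact Prod.ext (congrFun h 0) (funext fun j => congrFun h (j + 1))
    rw [himage, Set.ncard_image_of_injective _ hinj, h2]
    refine ⟨h1.image _, ?_⟩
    simp only [hQc]
    rfl

/-- The diagonal bit that enters the vertex at position `i`. -/
def enterBit (d : Bool) (x : ℕ → VertexBits) : ℕ → Bool
  | 0 => d
  | i + 1 => (x i).2.2

theorem isLayer_iff (k : ℕ) (d : Bool) (L B : ℕ → Bool) (x : ℕ → VertexBits) :
    IsLayer k d L B x ↔
      (∀ i < k, Ice (enterBit d x i) (L i) (B i) (x i).1 (x i).2.1 (x i).2.2) ∧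
      enterBit d x k = false ∧ ∀ i, k ≤ i → x i = (false, false, false) := by
  induction k generalizing d L B x with
  | zero => simp [IsLayer, enterBit]
  | succ k ih =>
    have he (i : ℕ) : enterBit (x 0).2.2 (fun i => x (i + 1)) i = enterBit d x (i + 1) := by
      cases i <;> rfl
    simp only [IsLayer, ih, he]
    constructor
    · rintro ⟨h1, h2, h3, h4⟩
      refine ⟨fun i hi => ?_, h3, fun i hi => ?_⟩
      · cases i with
        | zero => exact h1
        | succ i => exact h2 i (by omega)
      · cases i with
        | zero => omega
        | succ i => exact h4 i (by omega)
    · rintro ⟨h1, h2, h3⟩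
      exact ⟨h1 0 (by omega), fun i hi => h1 (i + 1) (by omega), h2,
        fun i hi => h3 (i + 1) (by omega)⟩

/-- Left bits of layer `j`. -/
def layerLeft (L : ℕ → Bool) (X : ℕ → ℕ → VertexBits) : ℕ → ℕ → Bool
  | 0, i => L i
  | j + 1, i => (X j i).2.1

/-- Bottom bits of layer `j`. -/
def layerBottom (B : ℕ → Bool) (X : ℕ → ℕ → VertexBits) : ℕ → ℕ → Bool
  | 0, i => B i
  | j + 1, i => (X j (i + 1)).1

/-- The recursion is unrolled into conditions at each vertex `(j, i)`, ready for comparison with the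
lattice. The last clause fixes the unused entries, so that each configuration has one encoding. -/
theorem isLayered_iff (k : ℕ) (L B : ℕ → Bool) (X : ℕ → ℕ → VertexBits) :
    IsLayered k L B X ↔
      (∀ j i, j + i < k → Ice (enterBit false (X j) i) (layerLeft L X j i) (layerBottom B X j i)
        (X j i).1 (X j i).2.1 (X j i).2.2) ∧
      (∀ j < k, (X j 0).1 = false) ∧
      (∀ j i, j + i + 1 = k → (X j i).2.1 = false) ∧
      (∀ j i, j + i + 1 = k → (X j i).2.2 = false) ∧
      ∀ j i, k ≤ j + i → X j i = (false, false, false) := by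
  induction k generalizing L B X with
  | zero => simp [IsLayered]
  | succ k ih =>
    have hl (j i : ℕ) : layerLeft (fun i => (X 0 i).2.1) (fun j => X (j + 1)) j i =
        layerLeft L X (j + 1) i := by cases j <;> rfl
    have hb (j i : ℕ) : layerBottom (fun i => (X 0 (i + 1)).1) (fun j => X (j + 1)) j i =
        layerBottom B X (j + 1) i := by cases j <;> rfl
    simp only [IsLayered, ih, isLayer_iff, hl, hb]
    constructor
    · rintro ⟨⟨h1, h2, h3⟩, h4, h5, h6, h7, h8, h9, h10⟩
      refine ⟨fun j i h => ?_, fun j h => ?_, fun j i h => ?_, fun j i h => ?_, fun j i h => ?_⟩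
      · cases j with
        | zero => exact h1 i (by omega)
        | succ j => exact h6 j i (by omega)
      · cases j with
        | zero => exact h4
        | succ j => exact h7 j (by omega)
      · cases j with
        | zero => obtain rfl : i = k := by omega
                  exact h5
        | succ j => exact h8 j i (by omega)
      · cases j with
        | zero => obtain rfl : i = k := by omega
                  exact h2
        | succ j => exact h9 j i (by omega)
      · cases j with
        | zero => exact h3 i (by omega)
        | succ j => exact h10 j i (by omega)
    · rintro ⟨h1, h2, h3, h4, h5⟩
      refine ⟨⟨fun i hi => h1 0 i (by omega), h4 0 k (by omega), fun i hi => h5 0 i (by omega)⟩,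
        h2 0 (by omega), h3 0 k (by omega), fun j i h => h1 (j + 1) i (by omega),
        fun j h => h2 (j + 1) (by omega), fun j i h => h3 (j + 1) i (by omega),
        fun j i h => h4 (j + 1) i (by omega), fun j i h => h5 (j + 1) i (by omega)⟩

/-! ### From edge orientations to path bits. -/

variable {m : ℕ}

theorem mem_triangleVertices {p : ℤ × ℤ} : p ∈ triangleVertices m ↔
    1 - (m : ℤ) ≤ p.1 ∧ p.1 ≤ 0 ∧ 0 ≤ p.2 ∧ p.2 ≤ m - 1 ∧ 0 ≤ p.1 + p.2 := by
  simp [triangleVertices, and_assoc]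

theorem mem_triangleEdges {e : (ℤ × ℤ) × (ℤ × ℤ)} : e ∈ triangleEdges m ↔
    (e.1 ∈ triangleVertices m ∨ e.2 ∈ triangleVertices m) ∧
    (e.2.1 = e.1.1 + 1 ∧ e.2.2 = e.1.2 ∨ e.2.1 = e.1.1 + 1 ∧ e.2.2 = e.1.2 - 1 ∨
      e.2.1 = e.1.1 ∧ e.2.2 = e.1.2 - 1) := by
  obtain ⟨⟨a, b⟩, ⟨c, d⟩⟩ := e
  have key : ((a, b), (c, d)) ∈ triangleEdges m ↔ ∃ s ∈ latticeSteps,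
      ((a, b) ∈ triangleVertices m ∨ (c, d) ∈ triangleVertices m) ∧ (c, d) = (a, b) + s := by
    simp only [triangleEdges, Finset.mem_biUnion, Finset.mem_insert, Finset.mem_singleton,
      Prod.mk.injEq]
    constructor
    · rintro ⟨v, hv, s, hs, ⟨h1, h2⟩ | ⟨h1, h2⟩⟩
      · exact ⟨s, hs, Or.inl (h1 ▸ hv), by rw [h1, h2]⟩
      · exact ⟨s, hs, Or.inr (h2 ▸ hv), by rw [h1, h2]; simp⟩
    · rintro ⟨s, hs, h | h, h'⟩
      · exact ⟨_, h, s, hs, Or.inl ⟨rfl, h'⟩⟩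
      · exact ⟨_, h, s, hs, Or.inr ⟨by rw [h']; simp, rfl⟩⟩
  rw [key]
  simp only [latticeSteps, Finset.mem_insert, Finset.mem_singleton, exists_eq_or_imp,
    exists_eq_left, Prod.mk_add_mk, Prod.mk.injEq, ← and_or_left, add_zero, ← sub_eq_add_neg]

/-- The path bit of an edge: the value of the orientation, extended by `false`. -/
noncomputable def bit (σ : EdgeOrientation m) (e : (ℤ × ℤ) × (ℤ × ℤ)) : Bool :=
  if h : e ∈ triangleEdges m then σ ⟨e, h⟩ else false

theorem bit_coe (σ : EdgeOrientation m) (e : triangleEdges m) : bit σ e.1 = σ e := by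
  simp [bit]

theorem bit_of_mem (σ : EdgeOrientation m) {e : (ℤ × ℤ) × (ℤ × ℤ)} (h : e ∈ triangleEdges m) :
    bit σ e = σ ⟨e, h⟩ := by
  simp [bit, h]

/-- Counting the edges incident to a vertex that satisfy a property determined by their bit. -/
theorem card_filter_incident (σ : EdgeOrientation m) {x y : ℤ} (hv : (x, y) ∈ triangleVertices m)
    (end' : Bool → (ℤ × ℤ) × (ℤ × ℤ) → ℤ × ℤ) (h : ∀ b e, end' b e = e.1 ∨ end' b e = e.2) :
    (Finset.univ.filter fun e : triangleEdges m => end' (σ e) e.1 = (x, y)).card =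
    ∑ e ∈ {((x - 1, y + 1), (x, y)), ((x - 1, y), (x, y)), ((x, y + 1), (x, y)),
      ((x, y), (x + 1, y - 1)), ((x, y), (x + 1, y)), ((x, y), (x, y - 1))},
      if end' (bit σ e) e = (x, y) then 1 else 0 := by
  rw [Finset.card_filter]
  simp only [← bit_coe σ]
  rw [Finset.sum_coe_sort (triangleEdges m) fun e => if end' (bit σ e) e = (x, y) then 1 else 0]
  symm
  refine Finset.sum_subset ?_ ?_
  · intro e he
    simp only [Finset.mem_insert, Finset.mem_singleton] at he
    rw [mem_triangleEdges]
    rcases he with rfl | rfl | rfl | rfl | rfl | rfl <;> simp [hv]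
  · rintro ⟨⟨a, b⟩, ⟨c, d⟩⟩ he hn
    rw [mem_triangleEdges] at he
    simp only [Finset.mem_insert, Finset.mem_singleton, Prod.mk.injEq] at hn
    rw [if_neg]
    intro h'
    rcases h (bit σ ((a, b), (c, d))) ((a, b), (c, d)) with h'' | h'' <;> rw [h''] at h' <;>
      simp only [Prod.mk.injEq] at h' he <;> omega

/-- Left, top and upper left edges point in when their bit is `true`, the other three when it is
`false`. The in-degree is therefore `3 + (d + l + t) - (r + b + e)`. -/
theorem iceRule_iff (σ : EdgeOrientation m) {x y : ℤ} (hv : (x, y) ∈ triangleVertices m) :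
    σ.IceRule (x, y) ↔ Ice (bit σ ((x - 1, y + 1), (x, y))) (bit σ ((x - 1, y), (x, y)))
      (bit σ ((x, y), (x, y - 1))) (bit σ ((x, y + 1), (x, y)))
      (bit σ ((x, y), (x + 1, y))) (bit σ ((x, y), (x + 1, y - 1))) := by
  have h1 := card_filter_incident σ hv (fun b e => if b = true then e.2 else e.1)
    fun b e => by cases b <;> simp
  have h2 := card_filter_incident σ hv (fun b e => if b = true then e.1 else e.2)
    fun b e => by cases b <;> simp
  unfold EdgeOrientation.IceRule EdgeOrientation.head EdgeOrientation.tail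
  rw [h1, h2]
  rw [Finset.sum_insert (by simp), Finset.sum_insert (by simp), Finset.sum_insert (by simp),
    Finset.sum_insert (by simp), Finset.sum_insert (by simp), Finset.sum_singleton,
    Finset.sum_insert (by simp), Finset.sum_insert (by simp), Finset.sum_insert (by simp),
    Finset.sum_insert (by simp), Finset.sum_insert (by simp), Finset.sum_singleton]
  generalize bit σ ((x - 1, y + 1), (x, y)) = d
  generalize bit σ ((x - 1, y), (x, y)) = l
  generalize bit σ ((x, y), (x, y - 1)) = b
  generalize bit σ ((x, y + 1), (x, y)) = t
  generalize bit σ ((x, y), (x + 1, y)) = r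
  generalize bit σ ((x, y), (x + 1, y - 1)) = e
  unfold Ice
  cases d <;> cases l <;> cases b <;> cases t <;> cases r <;> cases e <;> simp

/-- Which endpoint lies outside decides the bit: the first on the North side and for horizontal
edges of the diagonal side, the second on the East side and for vertical edges of the diagonal side.
-/
theorem pointsIn_iff (σ : EdgeOrientation m) (e : triangleEdges m)
    (h : e.1.1 ∉ triangleVertices m ∨ e.1.2 ∉ triangleVertices m) :
    σ.PointsIn e ↔ σ e = decide (e.1.1 ∉ triangleVertices m) := by
  have := (mem_triangleEdges.1 e.2).1
  unfold EdgeOrientation.PointsIn EdgeOrientation.tail EdgeOrientation.head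
  cases σ e <;> by_cases h1 : e.1.1 ∈ triangleVertices m <;>
    by_cases h2 : e.1.2 ∈ triangleVertices m <;> simp_all

theorem pointsOut_iff (σ : EdgeOrientation m) (e : triangleEdges m)
    (h : e.1.1 ∉ triangleVertices m ∨ e.1.2 ∉ triangleVertices m) :
    σ.PointsOut e ↔ σ e = decide (e.1.1 ∈ triangleVertices m) := by
  have := (mem_triangleEdges.1 e.2).1
  unfold EdgeOrientation.PointsOut EdgeOrientation.tail EdgeOrientation.head
  cases σ e <;> by_cases h1 : e.1.1 ∈ triangleVertices m <;>
    by_cases h2 : e.1.2 ∈ triangleVertices m <;> simp_all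

/-- The boundary conditions in terms of path bits. -/
theorem is20V3Configuration_iff (σ : EdgeOrientation m) : Is20V3Configuration σ ↔
    (∀ v ∈ triangleVertices m, σ.IceRule v) ∧
    (∀ e, IsNorthEdge e → σ e = false) ∧ (∀ e, IsEastEdge e → σ e = false) ∧
    (∀ e, IsDiagHorizontalEdge e → σ e = decide ((m : ℤ) - 1 ≤ 2 * e.1.1.2)) ∧
    (∀ e, IsDiagVerticalEdge e → σ e = decide (2 * e.1.1.2 ≤ (m : ℤ) - 1)) := by
  have hN (e : triangleEdges m) (h : IsNorthEdge e) : e.1.1 ∉ triangleVertices m := by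
    unfold IsNorthEdge at h; rw [mem_triangleVertices]; omega
  have hE (e : triangleEdges m) (h : IsEastEdge e) : e.1.2 ∉ triangleVertices m := by
    unfold IsEastEdge at h; rw [mem_triangleVertices]; omega
  have hH (e : triangleEdges m) (h : IsDiagHorizontalEdge e) : e.1.1 ∉ triangleVertices m := by
    unfold IsDiagHorizontalEdge at h; rw [mem_triangleVertices]; omega
  have hV (e : triangleEdges m) (h : IsDiagVerticalEdge e) : e.1.2 ∉ triangleVertices m := by
    unfold IsDiagVerticalEdge at h; rw [mem_triangleVertices]; omega
  have hm (e : triangleEdges m) (h : e.1.2 ∉ triangleVertices m) : e.1.1 ∈ triangleVertices m :=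
    (mem_triangleEdges.1 e.2).1.resolve_right h
  constructor
  · rintro ⟨h1, h2, h3, h4, h5, h6, h7⟩
    refine ⟨h1, fun e he => ?_, fun e he => ?_, fun e he => ?_, fun e he => ?_⟩
    · rw [(pointsOut_iff σ e (Or.inl (hN e he))).1 (h2 e he)]
      simp [hN e he]
    · rw [(pointsIn_iff σ e (Or.inr (hE e he))).1 (h3 e he)]
      simp [hm e (hE e he)]
    · rcases lt_trichotomy (2 * e.1.1.2) ((m : ℤ) - 1) with h | h | h
      · rw [(pointsOut_iff σ e (Or.inl (hH e he))).1 (h5 e (Or.inl he) h)]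
        simp [hH e he]; omega
      · rw [(pointsIn_iff σ e (Or.inl (hH e he))).1 (h6 e he h)]
        simp [hH e he, h]
      · rw [(pointsIn_iff σ e (Or.inl (hH e he))).1 (h4 e (Or.inl he) h)]
        simp [hH e he, h.le]
    · rcases lt_trichotomy (2 * e.1.1.2) ((m : ℤ) - 1) with h | h | h
      · rw [(pointsOut_iff σ e (Or.inr (hV e he))).1 (h5 e (Or.inr he) h)]
        simp [hm e (hV e he), h.le]
      · rw [(pointsOut_iff σ e (Or.inr (hV e he))).1 (h7 e he h)]
        simp [hm e (hV e he), h]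
      · rw [(pointsIn_iff σ e (Or.inr (hV e he))).1 (h4 e (Or.inr he) h)]
        simp [hm e (hV e he)]; omega
  · rintro ⟨h1, h2, h3, h4, h5⟩
    refine ⟨h1, fun e he => ?_, fun e he => ?_, fun e he h => ?_, fun e he h => ?_,
      fun e he h => ?_, fun e he h => ?_⟩
    · rw [pointsOut_iff σ e (Or.inl (hN e he)), h2 e he]
      simp [hN e he]
    · rw [pointsIn_iff σ e (Or.inr (hE e he)), h3 e he]
      simp [hm e (hE e he)]
    · rcases he with he | he
      · rw [pointsIn_iff σ e (Or.inl (hH e he)), h4 e he]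
        simp [hH e he, h.le]
      · rw [pointsIn_iff σ e (Or.inr (hV e he)), h5 e he]
        simp [hm e (hV e he)]; omega
    · rcases he with he | he
      · rw [pointsOut_iff σ e (Or.inl (hH e he)), h4 e he]
        simp [hH e he]; omega
      · rw [pointsOut_iff σ e (Or.inr (hV e he)), h5 e he]
        simp [hm e (hV e he), h.le]
    · rw [pointsIn_iff σ e (Or.inl (hH e he)), h4 e he]
      simp [hH e he, h]
    · rw [pointsOut_iff σ e (Or.inr (hV e he)), h5 e he]
      simp [hm e (hV e he), h]

/-! ### The bijection between orientations and layered bits. -/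

/-- The orientation `σ` and the layered bits `X` agree, where the vertex at position `i` of
antidiagonal `j` is `(j - m + 1 + i, m - 1 - i)`; on the diagonal side `σ` has the prescribed
boundary bits. -/
structure Agrees (σ : EdgeOrientation m) (X : ℕ → ℕ → VertexBits) : Prop where
  top : ∀ (j i : ℕ) (a b c d : ℤ), j + i < m → a = j - m + 1 + i → b = m - i → c = a →
    d = b - 1 → bit σ ((a, b), (c, d)) = (X j i).1
  right : ∀ (j i : ℕ) (a b c d : ℤ), j + i < m → a = j - m + 1 + i → b = m - 1 - i → c = a + 1 →
    d = b → bit σ ((a, b), (c, d)) = (X j i).2.1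
  lower : ∀ (j i : ℕ) (a b c d : ℤ), j + i < m → a = j - m + 1 + i → b = m - 1 - i → c = a + 1 →
    d = b - 1 → bit σ ((a, b), (c, d)) = (X j i).2.2
  enter : ∀ (j : ℕ) (a b c d : ℤ), j < m → a = j - m → b = m → c = a + 1 →
    d = b - 1 → bit σ ((a, b), (c, d)) = false
  left : ∀ (i : ℕ) (a b c d : ℤ), i < m → a = i - m → b = m - 1 - i → c = a + 1 →
    d = b → bit σ ((a, b), (c, d)) = leftBits m i
  bottom : ∀ (i : ℕ) (a b c d : ℤ), i < m → a = i - m + 1 → b = m - 1 - i → c = a →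
    d = b - 1 → bit σ ((a, b), (c, d)) = bottomBits m i
  support : ∀ j i, m ≤ j + i → X j i = (false, false, false)

/-- Every edge is the top, right or lower right edge of a vertex, or an external edge at the upper
left, left or bottom of a vertex. -/
theorem edge_cases {a b c d : ℤ} (h : ((a, b), (c, d)) ∈ triangleEdges m) :
    (∃ j i : ℕ, j + i < m ∧ a = j - m + 1 + i ∧ b = m - i ∧ c = a ∧ d = b - 1) ∨
    (∃ j i : ℕ, j + i < m ∧ a = j - m + 1 + i ∧ b = m - 1 - i ∧ c = a + 1 ∧ d = b) ∨
    (∃ j i : ℕ, j + i < m ∧ a = j - m + 1 + i ∧ b = m - 1 - i ∧ c = a + 1 ∧ d = b - 1) ∨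
    (∃ j : ℕ, j < m ∧ a = j - m ∧ b = m ∧ c = a + 1 ∧ d = b - 1) ∨
    (∃ i : ℕ, i < m ∧ a = i - m ∧ b = m - 1 - i ∧ c = a + 1 ∧ d = b) ∨
    (∃ i : ℕ, i < m ∧ a = i - m + 1 ∧ b = m - 1 - i ∧ c = a ∧ d = b - 1) := by
  rw [mem_triangleEdges] at h
  simp only [mem_triangleVertices] at h
  obtain ⟨h, ⟨h1, h2⟩ | ⟨h1, h2⟩ | ⟨h1, h2⟩⟩ := h
  · by_cases hp : 0 ≤ a + b
    · exact .inr (.inl ⟨(a + b).toNat, (m - 1 - b).toNat, by omega, by omega, by omega, h1, h2⟩)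
    · exact .inr (.inr (.inr (.inr (.inl ⟨(m - 1 - b).toNat, by omega, by omega, by omega, h1,
        h2⟩))))
  · by_cases hp : b = m
    · exact .inr (.inr (.inr (.inl ⟨(a + b).toNat, by omega, by omega, by omega, h1, h2⟩)))
    -- The only diagonal edge starting at `x = -m` starts at `(-m, m)`, already covered by `b = m`.
    · by_cases hq : a = - m
      · omega
      · exact .inr (.inr (.inl ⟨(a + b).toNat, (m - 1 - b).toNat, by omega, by omega, by omega, h1,
          h2⟩))
  · by_cases hp : 0 ≤ c + d
    · exact .inl ⟨(c + d).toNat, (m - b).toNat, by omega, by omega, by omega, h1, h2⟩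
    · exact .inr (.inr (.inr (.inr (.inr ⟨(m - 1 - b).toNat, by omega, by omega, by omega, h1,
        h2⟩))))

/-- With `Agrees.bits_unique`, this makes `layeredBits` and `orientationOfBits` mutually inverse on
configurations without computing either composite. -/
theorem Agrees.orientation_unique {σ σ' : EdgeOrientation m} {X : ℕ → ℕ → VertexBits}
    (h : Agrees σ X) (h' : Agrees σ' X) : σ = σ' := by
  funext ⟨⟨⟨a, b⟩, ⟨c, d⟩⟩, he⟩
  rw [← bit_of_mem σ he, ← bit_of_mem σ' he]
  rcases edge_cases he with ⟨j, i, h0, h1, h2, h3, h4⟩ | ⟨j, i, h0, h1, h2, h3, h4⟩ |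
    ⟨j, i, h0, h1, h2, h3, h4⟩ | ⟨j, h0, h1, h2, h3, h4⟩ | ⟨i, h0, h1, h2, h3, h4⟩ |
    ⟨i, h0, h1, h2, h3, h4⟩
  · rw [h.top j i _ _ _ _ h0 h1 h2 h3 h4, h'.top j i _ _ _ _ h0 h1 h2 h3 h4]
  · rw [h.right j i _ _ _ _ h0 h1 h2 h3 h4, h'.right j i _ _ _ _ h0 h1 h2 h3 h4]
  · rw [h.lower j i _ _ _ _ h0 h1 h2 h3 h4, h'.lower j i _ _ _ _ h0 h1 h2 h3 h4]
  · rw [h.enter j _ _ _ _ h0 h1 h2 h3 h4, h'.enter j _ _ _ _ h0 h1 h2 h3 h4]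
  · rw [h.left i _ _ _ _ h0 h1 h2 h3 h4, h'.left i _ _ _ _ h0 h1 h2 h3 h4]
  · rw [h.bottom i _ _ _ _ h0 h1 h2 h3 h4, h'.bottom i _ _ _ _ h0 h1 h2 h3 h4]

theorem Agrees.bits_unique {σ : EdgeOrientation m} {X X' : ℕ → ℕ → VertexBits}
    (h : Agrees σ X) (h' : Agrees σ X') : X = X' := by
  funext j i
  by_cases hji : j + i < m
  · refine Prod.ext ?_ (Prod.ext ?_ ?_)
    · rw [← h.top j i _ _ _ _ hji rfl rfl rfl rfl, ← h'.top j i _ _ _ _ hji rfl rfl rfl rfl]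
    · rw [← h.right j i _ _ _ _ hji rfl rfl rfl rfl, ← h'.right j i _ _ _ _ hji rfl rfl rfl rfl]
    · rw [← h.lower j i _ _ _ _ hji rfl rfl rfl rfl, ← h'.lower j i _ _ _ _ hji rfl rfl rfl rfl]
  · rw [h.support j i (by omega), h'.support j i (by omega)]

/-- The layered bits of an orientation. -/
noncomputable def layeredBits (σ : EdgeOrientation m) (j i : ℕ) : VertexBits :=
  if j + i < m then
    (bit σ (((j : ℤ) - m + 1 + i, (m : ℤ) - i), ((j : ℤ) - m + 1 + i, (m : ℤ) - i - 1)),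
      bit σ (((j : ℤ) - m + 1 + i, (m : ℤ) - 1 - i), ((j : ℤ) - m + 1 + i + 1, (m : ℤ) - 1 - i)),
      bit σ (((j : ℤ) - m + 1 + i, (m : ℤ) - 1 - i),
        ((j : ℤ) - m + 1 + i + 1, (m : ℤ) - 1 - i - 1)))
  else (false, false, false)

theorem agrees_layeredBits {σ : EdgeOrientation m} (h : Is20V3Configuration σ) :
    Agrees σ (layeredBits σ) := by
  obtain ⟨-, hN, -, hH, hV⟩ := (is20V3Configuration_iff σ).1 h
  refine ⟨?_, ?_, ?_, ?_, ?_, ?_, ?_⟩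
  · rintro j i a b c d h0 rfl rfl rfl rfl
    simp [layeredBits, h0]
  · rintro j i a b c d h0 rfl rfl rfl rfl
    simp [layeredBits, h0]
  · rintro j i a b c d h0 rfl rfl rfl rfl
    simp [layeredBits, h0]
  · intro j a b c d h0 h1 h2 h3 h4
    have he : ((a, b), (c, d)) ∈ triangleEdges m := by
      simp only [mem_triangleEdges, mem_triangleVertices]; omega
    rw [bit_of_mem σ he]
    exact hN _ h2
  · intro i a b c d h0 h1 h2 h3 h4
    have he : ((a, b), (c, d)) ∈ triangleEdges m := by
      simp only [mem_triangleEdges, mem_triangleVertices]; omega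
    rw [bit_of_mem σ he, hH ⟨_, he⟩ (show a + b = -1 by omega), leftBits, decide_eq_decide]
    change (m : ℤ) - 1 ≤ 2 * b ↔ _
    omega
  · intro i a b c d h0 h1 h2 h3 h4
    have he : ((a, b), (c, d)) ∈ triangleEdges m := by
      simp only [mem_triangleEdges, mem_triangleVertices]; omega
    rw [bit_of_mem σ he, hV ⟨_, he⟩ (show c + d = -1 by omega), bottomBits, decide_eq_decide]
    change 2 * b ≤ (m : ℤ) - 1 ↔ _
    omega
  · intro j i h0
    simp [layeredBits, show ¬ j + i < m by omega]

/-- The orientation with given layered bits and the prescribed boundary bits. -/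
noncomputable def orientationOfBits (m : ℕ) (X : ℕ → ℕ → VertexBits) : EdgeOrientation m :=
  fun e =>
    if e.1.1.1 = e.1.2.1 then
      if e.1.2 ∈ triangleVertices m then
        (X (e.1.2.1 + e.1.2.2).toNat (m - 1 - e.1.2.2).toNat).1
      else bottomBits m (m - 1 - e.1.1.2).toNat
    else if e.1.1.2 = e.1.2.2 then
      if e.1.1 ∈ triangleVertices m then
        (X (e.1.1.1 + e.1.1.2).toNat (m - 1 - e.1.1.2).toNat).2.1
      else leftBits m (m - 1 - e.1.1.2).toNat
    else if e.1.1 ∈ triangleVertices m then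
      (X (e.1.1.1 + e.1.1.2).toNat (m - 1 - e.1.1.2).toNat).2.2
    else false

theorem agrees_orientationOfBits {X : ℕ → ℕ → VertexBits}
    (h : ∀ j i, m ≤ j + i → X j i = (false, false, false)) :
    Agrees (orientationOfBits m X) X := by
  refine ⟨?_, ?_, ?_, ?_, ?_, ?_, h⟩
  · intro j i a b c d h0 h1 h2 h3 h4
    have he : ((a, b), (c, d)) ∈ triangleEdges m := by
      simp only [mem_triangleEdges, mem_triangleVertices]; omega
    have hv : (c, d) ∈ triangleVertices m := by simp only [mem_triangleVertices]; omega
    rw [bit_of_mem _ he]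
    simp only [orientationOfBits]
    rw [if_pos (by omega), if_pos hv]
    congr <;> omega
  · intro j i a b c d h0 h1 h2 h3 h4
    have he : ((a, b), (c, d)) ∈ triangleEdges m := by
      simp only [mem_triangleEdges, mem_triangleVertices]; omega
    have hv : (a, b) ∈ triangleVertices m := by simp only [mem_triangleVertices]; omega
    rw [bit_of_mem _ he]
    simp only [orientationOfBits]
    rw [if_neg (by omega), if_pos (by omega), if_pos hv]
    congr <;> omega
  · intro j i a b c d h0 h1 h2 h3 h4
    have he : ((a, b), (c, d)) ∈ triangleEdges m := by
      simp only [mem_triangleEdges, mem_triangleVertices]; omega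
    have hv : (a, b) ∈ triangleVertices m := by simp only [mem_triangleVertices]; omega
    rw [bit_of_mem _ he]
    simp only [orientationOfBits]
    rw [if_neg (by omega), if_neg (by omega), if_pos hv]
    congr <;> omega
  · intro j a b c d h0 h1 h2 h3 h4
    have he : ((a, b), (c, d)) ∈ triangleEdges m := by
      simp only [mem_triangleEdges, mem_triangleVertices]; omega
    have hv : (a, b) ∉ triangleVertices m := by simp only [mem_triangleVertices]; omega
    rw [bit_of_mem _ he]
    simp only [orientationOfBits]
    rw [if_neg (by omega), if_neg (by omega), if_neg hv]
  · intro i a b c d h0 h1 h2 h3 h4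
    have he : ((a, b), (c, d)) ∈ triangleEdges m := by
      simp only [mem_triangleEdges, mem_triangleVertices]; omega
    have hv : (a, b) ∉ triangleVertices m := by simp only [mem_triangleVertices]; omega
    rw [bit_of_mem _ he]
    simp only [orientationOfBits]
    rw [if_neg (by omega), if_pos (by omega), if_neg hv]
    congr; omega
  · intro i a b c d h0 h1 h2 h3 h4
    have he : ((a, b), (c, d)) ∈ triangleEdges m := by
      simp only [mem_triangleEdges, mem_triangleVertices]; omega
    have hv : (c, d) ∉ triangleVertices m := by simp only [mem_triangleVertices]; omega
    rw [bit_of_mem _ he]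
    simp only [orientationOfBits]
    rw [if_pos (by omega), if_neg hv]
    congr; omega

theorem Agrees.iceRule_iff {σ : EdgeOrientation m} {X : ℕ → ℕ → VertexBits} (h : Agrees σ X)
    (j i : ℕ) (hji : j + i < m) (x y : ℤ) (hx : x = j - m + 1 + i) (hy : y = m - 1 - i) :
    σ.IceRule (x, y) ↔ Ice (enterBit false (X j) i) (layerLeft (leftBits m) X j i)
      (layerBottom (bottomBits m) X j i) (X j i).1 (X j i).2.1 (X j i).2.2 := by
  have hv : (x, y) ∈ triangleVertices m := by simp only [mem_triangleVertices]; omega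
  have h1 : bit σ ((x - 1, y + 1), (x, y)) = enterBit false (X j) i := by
    cases i with
    | zero => exact h.enter j _ _ _ _ (by omega) (by omega) (by omega) (by omega) (by omega)
    | succ i => exact h.lower j i _ _ _ _ (by omega) (by omega) (by omega) (by omega) (by omega)
  have h2 : bit σ ((x - 1, y), (x, y)) = layerLeft (leftBits m) X j i := by
    cases j with
    | zero => exact h.left i _ _ _ _ (by omega) (by omega) (by omega) (by omega) (by omega)
    | succ j => exact h.right j i _ _ _ _ (by omega) (by omega) (by omega) (by omega) (by omega)
  have h3 : bit σ ((x, y), (x, y - 1)) = layerBottom (bottomBits m) X j i := by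
    cases j with
    | zero => exact h.bottom i _ _ _ _ (by omega) (by omega) (by omega) (by omega) (by omega)
    | succ j =>
      exact h.top j (i + 1) _ _ _ _ (by omega) (by omega) (by omega) (by omega) (by omega)
  rw [TwentyVertex.iceRule_iff σ hv, h1, h2, h3,
    h.top j i _ _ _ _ hji (by omega) (by omega) (by omega) (by omega),
    h.right j i _ _ _ _ hji (by omega) (by omega) (by omega) (by omega),
    h.lower j i _ _ _ _ hji (by omega) (by omega) (by omega) (by omega)]

/-- `Agrees` already contains the diagonal-side data and the empty diagonal edges entering from the
North. Only the ice rule, the vertical North edges and the East edges remain to be matched. -/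
theorem Agrees.is20V3Configuration_iff {σ : EdgeOrientation m} {X : ℕ → ℕ → VertexBits}
    (h : Agrees σ X) :
    Is20V3Configuration σ ↔ IsLayered m (leftBits m) (bottomBits m) X := by
  rw [TwentyVertex.is20V3Configuration_iff, isLayered_iff]
  constructor
  · rintro ⟨h1, hN, hE, -, -⟩
    refine ⟨fun j i hji => ?_, fun j hj => ?_, fun j i hji => ?_, fun j i hji => ?_, h.support⟩
    · refine (h.iceRule_iff j i hji _ _ rfl rfl).1 (h1 _ ?_)
      simp only [mem_triangleVertices]; omega
    · rw [← h.top j 0 (j - m + 1) m _ _ (by omega) (by omega) (by omega) rfl rfl]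
      refine (bit_of_mem σ ?_).trans (hN ⟨_, ?_⟩ rfl) <;>
        simp only [mem_triangleEdges, mem_triangleVertices] <;> exact ⟨by omega, by simp⟩
    · rw [← h.right j i 0 j 1 j (by omega) (by omega) (by omega) (by omega) (by omega)]
      refine (bit_of_mem σ ?_).trans (hE ⟨_, ?_⟩ rfl) <;>
        simp only [mem_triangleEdges, mem_triangleVertices] <;> exact ⟨by omega, by simp⟩
    · rw [← h.lower j i 0 j 1 (j - 1) (by omega) (by omega) (by omega) (by omega) (by omega)]
      refine (bit_of_mem σ ?_).trans (hE ⟨_, ?_⟩ rfl) <;>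
        simp only [mem_triangleEdges, mem_triangleVertices] <;> exact ⟨by omega, by simp⟩
  · rintro ⟨h1, h2, h3, h4, -⟩
    refine ⟨?_, ?_, ?_, ?_, ?_⟩
    · rintro ⟨x, y⟩ hv
      simp only [mem_triangleVertices] at hv
      exact (h.iceRule_iff (x + y).toNat (m - 1 - y).toNat (by omega) x y (by omega)
        (by omega)).2 (h1 _ _ (by omega))
    all_goals
      rintro ⟨⟨⟨a, b⟩, ⟨c, d⟩⟩, he⟩ hb
      rw [← bit_of_mem σ he]
      simp only [IsNorthEdge, IsEastEdge, IsDiagHorizontalEdge, IsDiagVerticalEdge] at hb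
    · rcases edge_cases he with ⟨j, i, e0, e1, e2, e3, e4⟩ | ⟨j, i, e0, e1, e2, e3, e4⟩ |
        ⟨j, i, e0, e1, e2, e3, e4⟩ | ⟨j, e0, e1, e2, e3, e4⟩ | ⟨i, e0, e1, e2, e3, e4⟩ |
        ⟨i, e0, e1, e2, e3, e4⟩
      · obtain rfl : i = 0 := by omega
        rw [h.top j 0 _ _ _ _ e0 e1 e2 e3 e4, h2 j (by omega)]
      · omega
      · omega
      · exact h.enter j _ _ _ _ e0 e1 e2 e3 e4
      · omega
      · omega
    · rcases edge_cases he with ⟨j, i, e0, e1, e2, e3, e4⟩ | ⟨j, i, e0, e1, e2, e3, e4⟩ |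
        ⟨j, i, e0, e1, e2, e3, e4⟩ | ⟨j, e0, e1, e2, e3, e4⟩ | ⟨i, e0, e1, e2, e3, e4⟩ |
        ⟨i, e0, e1, e2, e3, e4⟩
      · omega
      · rw [h.right j i _ _ _ _ e0 e1 e2 e3 e4, h3 j i (by omega)]
      · rw [h.lower j i _ _ _ _ e0 e1 e2 e3 e4, h4 j i (by omega)]
      · exact h.enter j _ _ _ _ e0 e1 e2 e3 e4
      · omega
      · omega
    · simp only [mem_triangleEdges, mem_triangleVertices] at he
      rw [h.left (m - 1 - b).toNat _ _ _ _ (by omega) (by omega) (by omega) (by omega) (by omega),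
        leftBits, decide_eq_decide]
      dsimp only
      omega
    · simp only [mem_triangleEdges, mem_triangleVertices] at he
      rw [h.bottom (m - 1 - b).toNat _ _ _ _ (by omega) (by omega) (by omega) (by omega)
        (by omega), bottomBits, decide_eq_decide]
      dsimp only
      omega

theorem Z20V3_eq_partitionIce (m : ℕ) :
    (Z20V3 m : ℚ) = partitionIce m (leftBits m) (bottomBits m) := by
  have hX {X : ℕ → ℕ → VertexBits} (h : IsLayered m (leftBits m) (bottomBits m) X) :
      Agrees (orientationOfBits m X) X :=
    agrees_orientationOfBits ((isLayered_iff _ _ _ _).1 h).2.2.2.2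
  let e : {σ : EdgeOrientation m // Is20V3Configuration σ} ≃
      {X | IsLayered m (leftBits m) (bottomBits m) X} :=
    { toFun := fun σ => ⟨layeredBits σ.1,
        (agrees_layeredBits σ.2).is20V3Configuration_iff.1 σ.2⟩
      invFun := fun X => ⟨orientationOfBits m X.1, (hX X.2).is20V3Configuration_iff.2 X.2⟩
      left_inv := fun σ => Subtype.ext <| (hX
        ((agrees_layeredBits σ.2).is20V3Configuration_iff.1 σ.2)).orientation_unique
          (agrees_layeredBits σ.2)
      right_inv := fun X => Subtype.ext <| (agrees_layeredBits
        ((hX X.2).is20V3Configuration_iff.2 X.2)).bits_unique (hX X.2) }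
  rw [← (ncard_isLayered m (leftBits m) (bottomBits m)).2, Z20V3, Nat.card_congr e,
    Nat.card_coe_set_eq]

end TwentyVertex

theorem mainTheorem7 (n : ℕ) (hn : 1 ≤ n) : Z20V3 (2 * n) = 2 ^ n * Z20V3 (2 * n - 1) := by
  obtain ⟨n, rfl⟩ := Nat.exists_eq_add_of_le' hn
  have h := TwentyVertex.partitionHV_frozen n
  rw [← TwentyVertex.partitionIce_eq_partitionHV, ← TwentyVertex.partitionIce_eq_partitionHV,
    ← TwentyVertex.Z20V3_eq_partitionIce, ← TwentyVertex.Z20V3_eq_partitionIce] at h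
  exact_mod_cast h
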